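/- **Setting.** Let $d,D,T\ge 0$ be integers ($D$ is the feedback delay, $T$ the horizon), let $\triangle_{d-1}$ be the probability simplex in $\mathbb R^d$, let $q\ge 2$ be real with conjugate exponent $p=q/(q-1)$, and let $\lambda>0$. Let $\ell_t$ ($t\ge1$) be convex real-valued losses on $\triangle_{d-1}$, let $w_t\in\triangle_{d-1}$ be the plays, and let $g_t$ be a subgradient of $\ell_t$ at $w_t$, i.e. $\ell_t(v)\ge \ell_t(w_t)+\langle g_t,v-w_t\rangle$ for all $v\in\triangle_{d-1}$. Let $h_t\in\mathbb R^d$ be arbitrary hints. Put $r_t=\mathbf 1\langle g_t,w_t\rangle-g_t$ for $t\ge1$, $r_t=0$ for $t\le 0$, and $\mathrm{Regret}_T(u)=\sum_{t=1}^T(\ell_t(w_t)-\ell_t(u))$. With $\max$ and powers taken coordinatewise, the DORM iterates are $w_{t+1}=\tilde w_{t+1}/\langle\mathbf 1,\tilde w_{t+1}\rangle$ ($t\ge 0$) with $$\tilde w_{t+1}=\max\Big(0,\tfrac1\lambda\Big(\sum_{s=1}^{t-D}r_s+h_{t+1}\Big)\Big)^{q-1},$$ and the DORM+ iterates are $w_{t+1}=\tilde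 w_{t+1}/\langle\mathbf 1,\tilde w_{t+1}\rangle$ with $h_0=\tilde w_0=0$ and $$\tilde w_{t+1}=\max\Big(0,\tilde w_t^{\,p-1}+\tfrac1\lambda(r_{t-D}+h_{t+1}-h_t)\Big)^{q-1}.$$ Whenever $\tilde w_{t+1}=0$, the play $w_{t+1}$ may be any point of $\triangle_{d-1}$. Let $\mathrm{huber}(x,y)=\frac12x^2-\frac12\max(|x|-|y|,0)^2$. For $c\in[2,\infty]$ and $1\le t\le T$ set, for DORM, $$B_{t,c}=\mathrm{huber}\Big(\Big\|h_t-\sum_{s=t-D}^t r_s\Big\|_c,\ \|r_t\|_c\Big),$$ and, for DORM+, $$B_{t,c}=\mathrm{huber}\Big(\Big\|h_t-\sum_{s=t-D}^t r_s\Big\|_c,\ \|r_{t-D}+h_{t+1}-h_t\|_c\Big),$$ where in this last expression $h_{T+1}$ is taken to be $\sum_{s=T-D+1}^T r_s$. **Claim.** For every $u\in\triangle_{d-1}$ and every $\lambda>0$, the DORM iterates and the DORM+ iterates, each with its own $B_{t,c}$, satisfy $$\mathrm{Regret}_T(u)\ \le\ \inf_{\lambda'>0}\Big[\frac{\lambda'}2\|u\|_p^2+\frac1{\lambda'(p-1)}\sum_{t=1}^TB_{t,q}\Big]\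 =\ \sqrt{\frac{2\|u\|_p^2}{p-1}\sum_{t=1}^TB_{t,q}}\ \le\ \sqrt{2\,d^{2/q}(q-1)\sum_{t=1}^TB_{t,\infty}}.$$ If in addition $d\ge2$ and $q$ minimizes $q'\mapsto d^{2/q'}(q'-1)$ over $q'\ge2$, then $$\mathrm{Regret}_T(u)\ \le\ 2\sqrt{(2\log_2 d-1)\sum_{t=1}^TB_{t,\infty}}.$$ -/

import Mathlib

namespace DelayedRegretMatching

noncomputable section

/-- The `ℓ^c` norm of a vector, for `c ∈ [1, ∞]`. -/
def lpNorm {d : ℕ} (c : ENNReal) (v : Fin d → ℝ) : ℝ :=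
  ‖WithLp.toLp c v‖

/-- The Huber penalty `x² / 2 - ((|x| - |y|)₊)² / 2`. -/
def huber (x y : ℝ) : ℝ :=
  x ^ 2 / 2 - (max (|x| - |y|) 0) ^ 2 / 2

/-- The instantaneous regret vectors `r_t = 1 ⟨g_t, w_t⟩ - g_t` for `t ≥ 1`, with `r_0 = 0`.
Rounds are numbered from `1`, and regrets with index at most `0` are zero. Hence truncated
subtraction of indices in `ℕ` is harmless below: `r (t - D)` is `0` when `t ≤ D`, and a sum over
`Finset.Icc (t - D) t` is the sum over all rounds between `max 1 (t - D)` and `t`. -/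
def instRegret {d : ℕ} (g w : ℕ → Fin d → ℝ) : ℕ → Fin d → ℝ
  | 0 => 0
  | t + 1 => fun j => g (t + 1) ⬝ᵥ w (t + 1) - g (t + 1) j

/-- The unnormalized iterates of delayed optimistic regret matching (DORM), for delay `D`,
parameters `q` and `lam`, instantaneous regrets `r` and hints `h`. -/
def dormWeights {d : ℕ} (D : ℕ) (q lam : ℝ) (r h : ℕ → Fin d → ℝ) : ℕ → Fin d → ℝ
  | 0 => 0
  | t + 1 => fun j => (max 0 (((∑ s ∈ Finset.Icc 1 (t - D), r s j) + h (t + 1) j) / lam)) ^ (q - 1)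

/-- The unnormalized iterates of delayed optimistic regret matching+ (DORM+); `p` is the
conjugate exponent of `q`. -/
def dormPlusWeights {d : ℕ} (D : ℕ) (p q lam : ℝ) (r h : ℕ → Fin d → ℝ) : ℕ → Fin d → ℝ
  | 0 => 0
  | t + 1 => fun j =>
      (max 0 ((dormPlusWeights D p q lam r h t j) ^ (p - 1)
        + (r (t - D) j + h (t + 1) j - h t j) / lam)) ^ (q - 1)

/-- `w` is a play obtained by normalizing the nonnegative vector `v`: it is `v / ⟨1, v⟩`
when `v ≠ 0`, and an arbitrary point of the simplex when `v = 0`. -/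
def IsNormalization {d : ℕ} (v w : Fin d → ℝ) : Prop :=
  w ∈ stdSimplex ℝ (Fin d) ∧ (v ≠ 0 → w = (∑ j, v j)⁻¹ • v)

/-- The plays `w` (with linearized losses `g` and hints `h`) form a run of DORM. -/
def IsDORM {d : ℕ} (D : ℕ) (q lam : ℝ) (g h w : ℕ → Fin d → ℝ) : Prop :=
  ∀ t, 1 ≤ t → IsNormalization (dormWeights D q lam (instRegret g w) h t) (w t)

/-- The plays `w` (with linearized losses `g` and hints `h`) form a run of DORM+. -/
def IsDORMPlus {d : ℕ} (D : ℕ) (p q lam : ℝ) (g h w : ℕ → Fin d → ℝ) : Prop :=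
  h 0 = 0 ∧
    ∀ t, 1 ≤ t → IsNormalization (dormPlusWeights D p q lam (instRegret g w) h t) (w t)

/-- `g` is a subgradient at `w` of a loss `f` defined on the simplex. -/
def IsSubgradientAt {d : ℕ} (f : (Fin d → ℝ) → ℝ) (w g : Fin d → ℝ) : Prop :=
  ∀ v ∈ stdSimplex ℝ (Fin d), f w + g ⬝ᵥ (v - w) ≤ f v

/-- The regret of the plays `w` against `u` after `T` rounds with losses `loss`. -/
def regret {d : ℕ} (loss : ℕ → (Fin d → ℝ) → ℝ) (w : ℕ → Fin d → ℝ) (T : ℕ)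
    (u : Fin d → ℝ) : ℝ :=
  ∑ t ∈ Finset.Icc 1 T, (loss t (w t) - loss t u)

/-- The term `B_{t,c}` for DORM. -/
def dormB {d : ℕ} (D : ℕ) (r h : ℕ → Fin d → ℝ) (c : ENNReal) (t : ℕ) : ℝ :=
  huber (lpNorm c (h t - ∑ s ∈ Finset.Icc (t - D) t, r s)) (lpNorm c (r t))

/-- The hint sequence with its entry at `T + 1` replaced by `∑_{s = T - D + 1}^{T} r_s`. -/
def endHint {d : ℕ} (D T : ℕ) (r h : ℕ → Fin d → ℝ) : ℕ → Fin d → ℝ :=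
  Function.update h (T + 1) (∑ s ∈ Finset.Icc (T + 1 - D) T, r s)

/-- The term `B_{t,c}` for DORM+ with horizon `T`. -/
def dormPlusB {d : ℕ} (D T : ℕ) (r h : ℕ → Fin d → ℝ) (c : ENNReal) (t : ℕ) : ℝ :=
  huber (lpNorm c (h t - ∑ s ∈ Finset.Icc (t - D) t, r s))
    (lpNorm c (r (t - D) + endHint D T r h (t + 1) - h t))

end

end DelayedRegretMatching

/-!
Both algorithms play, up to normalization, the gradient of the potential `Φ(θ) = ‖θ₊‖_q² / 2` at a
dual variable `θ_t`. For DORM this is the sum of the observed regrets and the hint, and for DORM+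
it is `λ w̃_t^(p - 1)`; in both cases `θ_t` does not depend on `λ`, which is why the bound holds for
all step sizes at once. Because the plays are proportional to `∇Φ(θ_t)`, the regret vector `r_t` is
orthogonal to `∇Φ(θ_t)` (`posGrad_dotProduct_instRegret`).

The potential is convex (`posPotential_tangent_le`) and `(q - 1)`-smooth for the `ℓ^q` norm
(`posPotential_smooth`). These two facts alone yield the Lipschitz bound on the gradient
(`posGrad_sub_dotProduct_le`) and the lower bound on the Bregman divergence
(`posGrad_sub_dotProduct_le_bregman`). Write `e_t = ∑_{s=t-D}^t r_s - h_t` for the amount by which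
the delayed and hinted information misses the true cumulative regret. The quadratic bound is used
on a fraction `α` of `e_t` and the Lipschitz bound on the rest; the best `α` turns the sum of the
two into the Huber penalty (`exists_huber_eq`).

For DORM, each round raises `Φ(∑ r_s)` by at most `(q - 1) B_t` (`dorm_posPotential_le`). For DORM+,
the same holds for `Φ(θ_t)` corrected by `⟨∇Φ(θ_t), k_t⟩`, where `k_t` is the error pending before
round `t` (`dormPlus_posPotential_add_le`). The plays up to round `T` do not see `h_{T+1}`, so it
may be chosen to make the final error vanish; then `θ_{T+1}` dominates the cumulative regret
coordinatewise.

Finally the regret against `u` is at most `⟨∑ r_s, u⟩`, hence by Hölder's inequality at most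
`‖u‖_p √(2 Φ)`, which is the optimized bound (`regret_bounds_of_posPotential_le`).
-/

namespace DelayedRegretMatching

/-! ### The potential and its gradient -/

/-- The potential `‖x₊‖_q² / 2`, half the squared `ℓ^q` norm of the positive part of `x`. -/
noncomputable def posPotential {d : ℕ} (q : ℝ) (x : Fin d → ℝ) : ℝ :=
  1 / 2 * (∑ i, (max 0 (x i)) ^ q) ^ (2 / q)

/-- The gradient of `posPotential q`, that is `‖x₊‖_q^(2 - q) x₊^(q - 1)`. The formula gives the
correct value `0` when `x₊ = 0`. -/
noncomputable def posGrad {d : ℕ} (q : ℝ) (x : Fin d → ℝ) : Fin d → ℝ :=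
  fun i => (∑ j, (max 0 (x j)) ^ q) ^ (2 / q - 1) * (max 0 (x i)) ^ (q - 1)

theorem posPotential_zero {d : ℕ} {q : ℝ} (hq : 2 ≤ q) :
    posPotential q (0 : Fin d → ℝ) = 0 := by
  have h1 : q ≠ 0 := by positivity
  have h2 : 2 / q ≠ 0 := by positivity
  simp [posPotential, Real.zero_rpow h1, Real.zero_rpow h2]

theorem posPotential_max {d : ℕ} (q : ℝ) (x : Fin d → ℝ) :
    posPotential q (fun i => max 0 (x i)) = posPotential q x := by
  simp [posPotential]

theorem posGrad_max {d : ℕ} (q : ℝ) (x : Fin d → ℝ) :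
    posGrad q (fun i => max 0 (x i)) = posGrad q x := by
  funext i
  simp [posGrad]

theorem sum_max_rpow_nonneg {d : ℕ} (q : ℝ) (x : Fin d → ℝ) :
    0 ≤ ∑ i, (max 0 (x i)) ^ q := by positivity

theorem posPotential_nonneg {d : ℕ} (q : ℝ) (x : Fin d → ℝ) : 0 ≤ posPotential q x := by
  unfold posPotential; positivity

theorem posGrad_nonneg {d : ℕ} (q : ℝ) (x : Fin d → ℝ) (i : Fin d) : 0 ≤ posGrad q x i := by
  unfold posGrad; positivity

theorem sqrt_two_mul_posPotential {d : ℕ} {q : ℝ} (hq : 2 ≤ q) (x : Fin d → ℝ) :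
    √(2 * posPotential q x) = (∑ i, (max 0 (x i)) ^ q) ^ (1 / q) := by
  have hS := sum_max_rpow_nonneg q x
  rw [Real.sqrt_eq_iff_mul_self_eq (by have := posPotential_nonneg q x; positivity) (by positivity),
    ← Real.rpow_add_of_nonneg hS (by positivity) (by positivity), posPotential]
  ring_nf

theorem lpNorm_ofReal {d : ℕ} {c : ℝ} (hc : 0 < c) (v : Fin d → ℝ) :
    lpNorm (ENNReal.ofReal c) v = (∑ i, |v i| ^ c) ^ (1 / c) := by
  have h : (ENNReal.ofReal c).toReal = c := ENNReal.toReal_ofReal hc.le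
  rw [lpNorm, PiLp.norm_eq_sum (by rw [h]; exact hc), h]
  rfl

theorem lpNorm_ofReal_sq {d : ℕ} {c : ℝ} (hc : 0 < c) (v : Fin d → ℝ) :
    lpNorm (ENNReal.ofReal c) v ^ 2 = (∑ i, |v i| ^ c) ^ (2 / c) := by
  have hS : 0 ≤ ∑ i, |v i| ^ c := by positivity
  rw [lpNorm_ofReal hc, ← Real.rpow_natCast, ← Real.rpow_mul hS]
  push_cast
  ring_nf

theorem lpNorm_ofReal_nonneg {d : ℕ} {c : ℝ} (hc : 0 < c) (v : Fin d → ℝ) :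
    0 ≤ lpNorm (ENNReal.ofReal c) v := by
  rw [lpNorm_ofReal hc]; positivity

theorem lpNorm_ofReal_smul {d : ℕ} {c : ℝ} (hc : 0 < c) {a : ℝ} (ha : 0 ≤ a) (v : Fin d → ℝ) :
    lpNorm (ENNReal.ofReal c) (a • v) = a * lpNorm (ENNReal.ofReal c) v := by
  have hS : 0 ≤ ∑ i, |v i| ^ c := by positivity
  simp only [lpNorm_ofReal hc, Pi.smul_apply, smul_eq_mul, abs_mul, abs_of_nonneg ha,
    Real.mul_rpow ha (abs_nonneg _), ← Finset.mul_sum]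
  rw [Real.mul_rpow (by positivity) hS, ← Real.rpow_mul ha, mul_one_div_cancel hc.ne',
    Real.rpow_one]

theorem lpNorm_ofReal_neg {d : ℕ} {c : ℝ} (hc : 0 < c) (v : Fin d → ℝ) :
    lpNorm (ENNReal.ofReal c) (-v) = lpNorm (ENNReal.ofReal c) v := by
  simp [lpNorm_ofReal hc]

theorem lpNorm_ofReal_sub_comm {d : ℕ} {c : ℝ} (hc : 0 < c) (v w : Fin d → ℝ) :
    lpNorm (ENNReal.ofReal c) (v - w) = lpNorm (ENNReal.ofReal c) (w - v) := by
  rw [← neg_sub, lpNorm_ofReal_neg hc]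

/-! ### Convexity of the potential -/

/-- Hölder's inequality against a nonnegative vector, where only the positive part counts. -/
theorem dotProduct_le_lpNorm_mul_sqrt {d : ℕ} {p q : ℝ} (hq : 2 ≤ q) (hpq : p.HolderConjugate q)
    (x u : Fin d → ℝ) (hu : ∀ i, 0 ≤ u i) :
    x ⬝ᵥ u ≤ lpNorm (ENNReal.ofReal p) u * √(2 * posPotential q x) := by
  rw [sqrt_two_mul_posPotential hq, lpNorm_ofReal hpq.pos]
  calc x ⬝ᵥ u ≤ ∑ i, u i * max 0 (x i) := by
        refine Finset.sum_le_sum fun i _ => ?_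
        rw [mul_comm]
        exact mul_le_mul_of_nonneg_left (le_max_right _ _) (hu i)
    _ ≤ _ := Real.inner_le_Lp_mul_Lq _ _ _ hpq
    _ = _ := by simp only [abs_of_nonneg (le_max_left (0 : ℝ) _)]

/-- Euler's identity for the `2`-homogeneous potential. -/
theorem posGrad_dotProduct_self {d : ℕ} {q : ℝ} (hq : 2 ≤ q) (x : Fin d → ℝ) :
    posGrad q x ⬝ᵥ x = 2 * posPotential q x := by
  have hS := sum_max_rpow_nonneg q x
  have hterm : ∀ i, (max 0 (x i)) ^ (q - 1) * x i = (max 0 (x i)) ^ q := by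
    intro i
    rcases le_total (x i) 0 with h | h
    · rw [max_eq_left h, Real.zero_rpow (by linarith), Real.zero_rpow (by linarith), zero_mul]
    · rw [max_eq_right h]
      conv_lhs => rw [← Real.rpow_one (x i), ← Real.rpow_mul h, one_mul]
      rw [← Real.rpow_add_of_nonneg h (by linarith) (by linarith)]
      ring_nf
  have : posGrad q x ⬝ᵥ x = (∑ j, (max 0 (x j)) ^ q) ^ (2 / q - 1) * ∑ j, (max 0 (x j)) ^ q := by
    simp only [dotProduct, posGrad, mul_assoc, hterm, Finset.mul_sum]
  rw [this, posPotential]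
  rcases hS.eq_or_lt with h | h
  · rw [← h, mul_zero, Real.zero_rpow (by positivity)]; ring
  · conv_lhs => rw [← Real.rpow_one (∑ j, (max 0 (x j)) ^ q), ← Real.rpow_mul hS, one_mul,
      ← Real.rpow_add h]
    ring_nf

theorem lpNorm_posGrad {d : ℕ} {p q : ℝ} (hq : 2 ≤ q) (hpq : p.HolderConjugate q)
    (x : Fin d → ℝ) :
    lpNorm (ENNReal.ofReal p) (posGrad q x) = √(2 * posPotential q x) := by
  have hS := sum_max_rpow_nonneg q x
  rw [sqrt_two_mul_posPotential hq, lpNorm_ofReal hpq.pos]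
  have hmul : (q - 1) * p = q := hpq.symm.sub_one_mul_conj
  have hterm : ∀ i, |posGrad q x i| ^ p =
      ((∑ j, (max 0 (x j)) ^ q) ^ (2 / q - 1)) ^ p * (max 0 (x i)) ^ q := by
    intro i
    rw [abs_of_nonneg (posGrad_nonneg q x i), posGrad, Real.mul_rpow (by positivity)
      (by positivity), ← Real.rpow_mul (le_max_left _ _), hmul]
  simp only [hterm, ← Finset.mul_sum]
  rcases hS.eq_or_lt with h | h
  · rw [← h, mul_zero, Real.zero_rpow (by have := hpq.pos; positivity),
      Real.zero_rpow (by positivity)]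
  · rw [Real.mul_rpow (by positivity) hS, ← Real.rpow_mul (by positivity),
      mul_one_div_cancel hpq.pos.ne', Real.rpow_one, ← Real.rpow_add h]
    have h1 : 1 / p = 1 - 1 / q := by
      have := hpq.inv_add_inv_eq_one
      rw [one_div, one_div]; linarith
    rw [h1]
    congr 1
    ring

theorem posPotential_tangent_le {d : ℕ} {q : ℝ} (hq : 2 ≤ q) (x y : Fin d → ℝ) :
    posPotential q x + posGrad q x ⬝ᵥ (y - x) ≤ posPotential q y := by
  have hpq : (q.conjExponent).HolderConjugate q := (Real.HolderConjugate.conjExponent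
    (by linarith)).symm
  have h := dotProduct_le_lpNorm_mul_sqrt hq hpq y (posGrad q x) (posGrad_nonneg q x)
  rw [lpNorm_posGrad hq hpq] at h
  rw [dotProduct_sub, posGrad_dotProduct_self hq, dotProduct_comm]
  have hx := posPotential_nonneg q x
  have hy := posPotential_nonneg q y
  have h1 := Real.sq_sqrt (show 0 ≤ 2 * posPotential q x by positivity)
  have h2 := Real.sq_sqrt (show 0 ≤ 2 * posPotential q y by positivity)
  nlinarith [sq_nonneg (√(2 * posPotential q x) - √(2 * posPotential q y))]

/-! ### Smoothness of the potential -/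

theorem hasDerivAt_max_rpow {a : ℝ} (ha : 1 < a) (x : ℝ) :
    HasDerivAt (fun y : ℝ => (max 0 y) ^ a) (a * (max 0 x) ^ (a - 1)) x := by
  rcases lt_trichotomy x 0 with h | h | h
  · rw [max_eq_left h.le, Real.zero_rpow (by linarith), mul_zero]
    refine (hasDerivAt_const x (0 : ℝ)).congr_of_eventuallyEq ?_
    filter_upwards [eventually_lt_nhds h] with y hy
    rw [max_eq_left hy.le, Real.zero_rpow (by linarith)]
  · subst h
    have h1 : HasDerivWithinAt (fun y : ℝ => (max 0 y) ^ a) (a * (max 0 (0 : ℝ)) ^ (a - 1))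
        (Set.Iic 0) 0 := by
      rw [max_self, Real.zero_rpow (by linarith), mul_zero]
      refine (hasDerivWithinAt_const (0 : ℝ) _ (0 : ℝ)).congr (fun y hy => ?_) ?_
      · rw [max_eq_left hy, Real.zero_rpow (by linarith)]
      · rw [max_self, Real.zero_rpow (by linarith)]
    have h2 : HasDerivWithinAt (fun y : ℝ => (max 0 y) ^ a) (a * (max 0 (0 : ℝ)) ^ (a - 1))
        (Set.Ici 0) 0 := by
      rw [max_self]
      refine (Real.hasDerivAt_rpow_const (Or.inr ha.le)).hasDerivWithinAt.congr
        (fun y hy => ?_) ?_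
      · rw [max_eq_right hy]
      · rw [max_self]
    have h3 := h1.union h2
    rwa [Set.Iic_union_Ici, hasDerivWithinAt_univ] at h3
  · rw [max_eq_right h.le]
    refine (Real.hasDerivAt_rpow_const (Or.inr ha.le)).congr_of_eventuallyEq ?_
    filter_upwards [eventually_gt_nhds h] with y hy
    rw [max_eq_right hy.le]

theorem le_quadratic_of_deriv_deriv_le {f m m' : ℝ → ℝ} {K : ℝ}
    (hf : ∀ s, HasDerivAt f (m s) s) (hm : ∀ s, HasDerivAt m (m' s) s) (hK : ∀ s, m' s ≤ K) :
    f 1 ≤ f 0 + m 0 + K / 2 := by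
  have h1 : Antitone fun s => m s - K * s :=
    antitone_of_hasDerivAt_nonpos (f' := fun s => m' s - K * 1)
      (fun s => (hm s).sub ((hasDerivAt_id s).const_mul K)) (fun s => by
        have := hK s
        change m' s - K * 1 ≤ 0
        linarith)
  have h2 : AntitoneOn (fun s => f s - (m 0 * s + K / 2 * s ^ 2)) (Set.Icc 0 1) := by
    have hd : ∀ s, HasDerivAt (fun s => f s - (m 0 * s + K / 2 * s ^ 2))
        (m s - (m 0 * 1 + K / 2 * (2 * s))) s := fun s => by
      have := (hf s).fun_sub (((hasDerivAt_id' s).const_mul (m 0)).fun_add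
        ((hasDerivAt_pow 2 s).const_mul (K / 2)))
      simpa using this
    refine antitoneOn_of_hasDerivWithinAt_nonpos (convex_Icc 0 1)
      (fun s _ => (hd s).continuousAt.continuousWithinAt)
      (fun s _ => (hd s).hasDerivWithinAt) (fun s hs => ?_)
    have hs0 : 0 ≤ s := (interior_subset hs).1
    have := h1 hs0
    simp only [mul_zero, sub_zero] at this
    linarith
  have := h2 (Set.left_mem_Icc.2 zero_le_one) (Set.right_mem_Icc.2 zero_le_one) zero_le_one
  norm_num at this
  linarith

/-- Smoothness of the potential after adding `ε > 0` inside the power, which removes the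
singularity at the points whose positive part vanishes. The second derivative along a line is at
most `(q - 1) ‖z‖_q²`: one of its two terms is nonpositive because `2 / q ≤ 1`, the other is
bounded by Hölder's inequality with exponents `q / (q - 2)` and `q / 2`. -/
theorem regularized_smooth {d : ℕ} {q ε : ℝ} (hq : 2 < q) (hε : 0 < ε) (x z : Fin d → ℝ) :
    1 / 2 * (ε + ∑ i, (max 0 (x i + z i)) ^ q) ^ (2 / q) ≤
      1 / 2 * (ε + ∑ i, (max 0 (x i)) ^ q) ^ (2 / q)
      + (ε + ∑ i, (max 0 (x i)) ^ q) ^ (2 / q - 1) * (∑ i, (max 0 (x i)) ^ (q - 1) * z i)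
      + (q - 1) * (∑ i, |z i| ^ q) ^ (2 / q) / 2 := by
  set N : ℝ → ℝ := fun s => ε + ∑ i, (max 0 (x i + s * z i)) ^ q with hN
  set A : ℝ → ℝ := fun s => ∑ i, (max 0 (x i + s * z i)) ^ (q - 1) * z i with hA
  set A' : ℝ → ℝ := fun s => ∑ i, (max 0 (x i + s * z i)) ^ (q - 2) * z i ^ 2 with hA'
  have hS : ∀ s, 0 ≤ ∑ i, (max 0 (x i + s * z i)) ^ q := fun s => by positivity
  have hNpos : ∀ s, 0 < N s := fun s => by have := hS s; simp only [hN]; linarith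
  have hline : ∀ (s : ℝ) (i : Fin d), HasDerivAt (fun s => x i + s * z i) (z i) s := by
    intro s i
    simpa using ((hasDerivAt_id s).mul_const (z i)).const_add (x i)
  have hmax : ∀ a : ℝ, 1 < a → ∀ (s : ℝ) (i : Fin d),
      HasDerivAt (fun s => (max 0 (x i + s * z i)) ^ a)
        (a * (max 0 (x i + s * z i)) ^ (a - 1) * z i) s := fun a ha s i =>
    HasDerivAt.comp (h₂ := fun y : ℝ => (max 0 y) ^ a) s
      (hasDerivAt_max_rpow ha (x i + s * z i)) (hline s i)
  have hdN : ∀ s, HasDerivAt N (q * A s) s := by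
    intro s
    have h1 : HasDerivAt (fun s => ∑ i, (max 0 (x i + s * z i)) ^ q)
        (∑ i, q * (max 0 (x i + s * z i)) ^ (q - 1) * z i) s :=
      HasDerivAt.fun_sum fun i _ =>
        hmax q (by linarith) s i
    simpa only [hN, hA, Finset.mul_sum, mul_assoc] using h1.const_add ε
  have hdA : ∀ s, HasDerivAt A ((q - 1) * A' s) s := by
    intro s
    have h1 : HasDerivAt (fun s => ∑ i, (max 0 (x i + s * z i)) ^ (q - 1) * z i)
        (∑ i, (q - 1) * (max 0 (x i + s * z i)) ^ (q - 1 - 1) * z i * z i) s :=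
      HasDerivAt.fun_sum fun i _ =>
        HasDerivAt.mul_const (hmax (q - 1) (by linarith) s i) (z i)
    refine h1.congr_deriv ?_
    simp only [hA', Finset.mul_sum]
    refine Finset.sum_congr rfl fun i _ => ?_
    rw [show q - 1 - 1 = q - 2 by ring]
    ring
  have hdf : ∀ s, HasDerivAt (fun s => 1 / 2 * N s ^ (2 / q)) (N s ^ (2 / q - 1) * A s) s := by
    intro s
    refine (((hdN s).rpow_const (p := 2 / q) (Or.inl (hNpos s).ne')).const_mul
      (1 / 2)).congr_deriv ?_
    field_simp
  have hdm : ∀ s, HasDerivAt (fun s => N s ^ (2 / q - 1) * A s)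
      (q * A s * (2 / q - 1) * N s ^ (2 / q - 1 - 1) * A s
        + N s ^ (2 / q - 1) * ((q - 1) * A' s)) s := fun s =>
    ((hdN s).rpow_const (p := 2 / q - 1) (Or.inl (hNpos s).ne')).mul (hdA s)
  have hbound : ∀ s, q * A s * (2 / q - 1) * N s ^ (2 / q - 1 - 1) * A s
        + N s ^ (2 / q - 1) * ((q - 1) * A' s) ≤ (q - 1) * (∑ i, |z i| ^ q) ^ (2 / q) := by
    intro s
    have hN0 := hNpos s
    have hfirst : q * A s * (2 / q - 1) * N s ^ (2 / q - 1 - 1) * A s ≤ 0 := by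
      have : q * A s * (2 / q - 1) * N s ^ (2 / q - 1 - 1) * A s
          = (2 - q) * (N s ^ (2 / q - 1 - 1) * A s ^ 2) := by field_simp
      rw [this]
      exact mul_nonpos_of_nonpos_of_nonneg (by linarith) (by positivity)
    have hconj : (q / (q - 2)).HolderConjugate (q / 2) := by
      rw [Real.holderConjugate_iff]
      constructor
      · rw [lt_div_iff₀ (by linarith)]; linarith
      · field_simp; ring
    have hholder : A' s ≤ (N s) ^ (1 - 2 / q) * (∑ i, |z i| ^ q) ^ (2 / q) := by
      have h1 := Real.inner_le_Lp_mul_Lq_of_nonneg Finset.univ hconj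
        (f := fun i => (max 0 (x i + s * z i)) ^ (q - 2)) (g := fun i => z i ^ 2)
        (fun i _ => by positivity) (fun i _ => by positivity)
      have h2 : ∀ i, ((max 0 (x i + s * z i)) ^ (q - 2)) ^ (q / (q - 2))
          = (max 0 (x i + s * z i)) ^ q := fun i => by
        rw [← Real.rpow_mul (le_max_left _ _), mul_div_cancel₀ _ (by linarith)]
      have h3 : ∀ i, (z i ^ 2) ^ (q / 2) = |z i| ^ q := fun i => by
        rw [← sq_abs, ← Real.rpow_natCast, ← Real.rpow_mul (abs_nonneg _)]
        congr 1
        push_cast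
        ring
      simp only [h2, h3] at h1
      rw [show 1 / (q / (q - 2)) = 1 - 2 / q by field_simp, show 1 / (q / 2) = 2 / q by
        field_simp] at h1
      refine h1.trans (mul_le_mul_of_nonneg_right ?_ (by positivity))
      refine Real.rpow_le_rpow (hS s) (by simp only [hN]; linarith) ?_
      rw [sub_nonneg, div_le_one (by linarith)]
      exact hq.le
    have hcancel : N s ^ (2 / q - 1) * N s ^ (1 - 2 / q) = 1 := by
      rw [← Real.rpow_add hN0]
      norm_num
    have hsecond : N s ^ (2 / q - 1) * A' s ≤ (∑ i, |z i| ^ q) ^ (2 / q) := by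
      calc N s ^ (2 / q - 1) * A' s
          ≤ N s ^ (2 / q - 1) * ((N s) ^ (1 - 2 / q) * (∑ i, |z i| ^ q) ^ (2 / q)) :=
            mul_le_mul_of_nonneg_left hholder (by positivity)
        _ = _ := by rw [← mul_assoc, hcancel, one_mul]
    have := mul_le_mul_of_nonneg_left hsecond (show 0 ≤ q - 1 by linarith)
    linarith
  have := le_quadratic_of_deriv_deriv_le hdf hdm hbound
  simpa only [hN, hA, one_mul, zero_mul, add_zero] using this

/-- The potential is `(q - 1)`-smooth with respect to the `ℓ^q` norm. -/
theorem posPotential_smooth {d : ℕ} {q : ℝ} (hq : 2 ≤ q) (x z : Fin d → ℝ) :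
    posPotential q (x + z) ≤ posPotential q x + posGrad q x ⬝ᵥ z
      + (q - 1) / 2 * lpNorm (ENNReal.ofReal q) z ^ 2 := by
  have hq0 : 0 < q := by linarith
  rw [lpNorm_ofReal_sq hq0]
  rcases hq.eq_or_lt with rfl | hq
  · -- For `q = 2` the second derivative has kinks, but the bound holds coordinatewise.
    have h : ∀ i, (max 0 (x i + z i)) ^ 2 ≤ (max 0 (x i)) ^ 2 + 2 * (max 0 (x i) * z i)
        + z i ^ 2 := by
      intro i
      rcases le_total (x i) 0 with h1 | h1 <;> rcases le_total (x i + z i) 0 with h2 | h2 <;>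
        simp only [max_eq_left, max_eq_right, h1, h2] <;> nlinarith [sq_nonneg (x i + z i)]
    have h' := Finset.sum_le_sum fun i (_ : i ∈ Finset.univ) => h i
    rw [Finset.sum_add_distrib, Finset.sum_add_distrib, ← Finset.mul_sum] at h'
    norm_num [posPotential, posGrad, dotProduct]
    linarith
  · have hS := sum_max_rpow_nonneg q x
    have hgrad : posGrad q x ⬝ᵥ z = (∑ i, (max 0 (x i)) ^ q) ^ (2 / q - 1)
        * (∑ i, (max 0 (x i)) ^ (q - 1) * z i) := by
      simp only [dotProduct, posGrad, Finset.mul_sum, mul_assoc]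
    have hcont : ∀ S : ℝ, Filter.Tendsto (fun ε : ℝ => 1 / 2 * (ε + S) ^ (2 / q))
        (nhdsWithin 0 (Set.Ioi 0)) (nhds (1 / 2 * S ^ (2 / q))) := by
      intro S
      have : Continuous fun ε : ℝ => 1 / 2 * (ε + S) ^ (2 / q) :=
        continuous_const.mul ((continuous_id.add continuous_const).rpow_const
          fun _ => Or.inr (by positivity))
      simpa using this.continuousWithinAt (s := Set.Ioi 0) (x := 0) |>.tendsto
    have hcontG : Filter.Tendsto (fun ε : ℝ => (ε + ∑ i, (max 0 (x i)) ^ q) ^ (2 / q - 1)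
        * (∑ i, (max 0 (x i)) ^ (q - 1) * z i))
        (nhdsWithin 0 (Set.Ioi 0)) (nhds (posGrad q x ⬝ᵥ z)) := by
      rw [hgrad]
      rcases hS.eq_or_lt with h | h
      · have h0 : ∀ i, max 0 (x i) = 0 := fun i => by
          have := (Finset.sum_eq_zero_iff_of_nonneg (fun i _ => by positivity)).1 h.symm i
            (Finset.mem_univ i)
          exact (Real.rpow_eq_zero (le_max_left _ _) hq0.ne').1 this
        have hsum : (∑ i, (max 0 (x i)) ^ (q - 1) * z i) = 0 :=
          Finset.sum_eq_zero fun i _ => by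
            rw [h0, Real.zero_rpow (by linarith), zero_mul]
        simp [hsum]
      · have : ContinuousAt (fun ε : ℝ => (ε + ∑ i, (max 0 (x i)) ^ q) ^ (2 / q - 1)
            * (∑ i, (max 0 (x i)) ^ (q - 1) * z i)) 0 :=
          ((continuousAt_id.add continuousAt_const).rpow_const
            (Or.inl (by simpa using h.ne'))).mul continuousAt_const
        simpa using this.continuousWithinAt (s := Set.Ioi 0) |>.tendsto
    rw [show (q - 1) / 2 * (∑ i, |z i| ^ q) ^ (2 / q) = (q - 1) * (∑ i, |z i| ^ q) ^ (2 / q) / 2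
      by ring]
    refine le_of_tendsto_of_tendsto (hcont _) (((hcont _).add hcontG).add_const _) ?_
    filter_upwards [self_mem_nhdsWithin] with ε hε
    exact regularized_smooth hq hε x z

/-! ### The Huber penalty -/

theorem huber_nonneg (x y : ℝ) : 0 ≤ huber x y := by
  unfold huber
  have h1 : max (|x| - |y|) 0 ≤ |x| :=
    max_le (by linarith [abs_nonneg y]) (abs_nonneg x)
  have h2 := pow_le_pow_left₀ (le_max_right (|x| - |y|) 0) h1 2
  rw [sq_abs] at h2
  linarith

theorem huber_le_huber {x y x' y' : ℝ} (hx : 0 ≤ x) (hy : 0 ≤ y) (hxx : x ≤ x') (hyy : y ≤ y') :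
    huber x y ≤ huber x' y' := by
  unfold huber
  rw [abs_of_nonneg hx, abs_of_nonneg hy, abs_of_nonneg (hx.trans hxx),
    abs_of_nonneg (hy.trans hyy)]
  rcases le_total (x - y) 0 with h1 | h1 <;> rcases le_total (x' - y') 0 with h2 | h2 <;>
    simp only [max_eq_left, max_eq_right, h1, h2] <;> nlinarith

theorem huber_mul_mul {c : ℝ} (hc : 0 ≤ c) (x y : ℝ) :
    huber (c * x) (c * y) = c ^ 2 * huber x y := by
  unfold huber
  rw [abs_mul, abs_mul, abs_of_nonneg hc, ← mul_sub]
  have h := mul_max_of_nonneg (|x| - |y|) 0 hc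
  rw [mul_zero] at h
  rw [← h]
  ring

/-- The Huber penalty as an interpolation between the quadratic bound `a² / 2` and the bilinear
bound `a b`. -/
theorem exists_huber_eq {a b : ℝ} (ha : 0 ≤ a) (hb : 0 ≤ b) :
    ∃ α : ℝ, 0 ≤ α ∧ α ≤ 1 ∧ α ^ 2 / 2 * a ^ 2 + (1 - α) * (a * b) = huber a b := by
  unfold huber
  rw [abs_of_nonneg ha, abs_of_nonneg hb]
  rcases le_total a b with h | h
  · refine ⟨1, zero_le_one, le_rfl, ?_⟩
    rw [max_eq_right (by linarith)]
    ring
  · rw [max_eq_left (by linarith)]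
    rcases ha.eq_or_lt with rfl | ha'
    · refine ⟨1, zero_le_one, le_rfl, ?_⟩
      have : b = 0 := le_antisymm h hb
      simp [this]
    · refine ⟨b / a, by positivity, (div_le_one ha').2 h, ?_⟩
      field_simp
      ring

/-! ### One-step bounds for the potential -/

/-- A change of gradient is controlled by the Bregman divergence. -/
theorem posGrad_sub_dotProduct_le_bregman {d : ℕ} {q : ℝ} (hq : 2 ≤ q) (x y z : Fin d → ℝ) :
    (posGrad q y - posGrad q x) ⬝ᵥ z ≤
      (posPotential q x - posPotential q y - posGrad q y ⬝ᵥ (x - y))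
        + (q - 1) / 2 * lpNorm (ENNReal.ofReal q) z ^ 2 := by
  have h1 := posPotential_smooth hq x z
  have h2 := posPotential_tangent_le hq y (x + z)
  rw [show x + z - y = (x - y) + z by abel, dotProduct_add] at h2
  rw [sub_dotProduct]
  linarith

/-- The gradient is `(q - 1)`-Lipschitz from the `ℓ^q` norm to its dual norm, tested against a
vector `z`. -/
theorem posGrad_sub_dotProduct_le {d : ℕ} {q : ℝ} (hq : 2 ≤ q) (x y z : Fin d → ℝ) :
    (posGrad q y - posGrad q x) ⬝ᵥ z ≤
      (q - 1) * (lpNorm (ENNReal.ofReal q) (y - x) * lpNorm (ENNReal.ofReal q) z) := by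
  have hq0 : 0 < q := by linarith
  set G := posGrad q y - posGrad q x with hG
  have hsum : ∀ s : ℝ, 0 ≤ s → 2 * s * (G ⬝ᵥ z) ≤ G ⬝ᵥ (y - x)
      + (q - 1) * (s ^ 2 * lpNorm (ENNReal.ofReal q) z ^ 2) := by
    intro s hs
    have h1 := posGrad_sub_dotProduct_le_bregman hq x y (s • z)
    have h2 := posGrad_sub_dotProduct_le_bregman hq y x (-(s • z))
    rw [lpNorm_ofReal_neg hq0] at h2
    rw [lpNorm_ofReal_smul hq0 hs] at h1 h2
    have hb : G ⬝ᵥ (y - x) = posGrad q y ⬝ᵥ y - posGrad q y ⬝ᵥ x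
        - (posGrad q x ⬝ᵥ y - posGrad q x ⬝ᵥ x) := by
      rw [hG, sub_dotProduct, dotProduct_sub, dotProduct_sub]
    have hz : G ⬝ᵥ z = posGrad q y ⬝ᵥ z - posGrad q x ⬝ᵥ z := by rw [hG, sub_dotProduct]
    rw [hb, hz]
    simp only [sub_dotProduct, dotProduct_sub, dotProduct_neg, dotProduct_smul,
      smul_eq_mul] at h1 h2
    nlinarith
  have hdiag : G ⬝ᵥ (y - x) ≤ (q - 1) * lpNorm (ENNReal.ofReal q) (y - x) ^ 2 := by
    have h1 := posGrad_sub_dotProduct_le_bregman hq x y (y - x)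
    have h2 := posGrad_sub_dotProduct_le_bregman hq y x (x - y)
    rw [lpNorm_ofReal_sub_comm hq0 x y] at h2
    have hb : G ⬝ᵥ (y - x) = posGrad q y ⬝ᵥ y - posGrad q y ⬝ᵥ x
        - (posGrad q x ⬝ᵥ y - posGrad q x ⬝ᵥ x) := by
      rw [hG, sub_dotProduct, dotProduct_sub, dotProduct_sub]
    rw [hb]
    simp only [sub_dotProduct, dotProduct_sub] at h1 h2
    linarith
  set a := lpNorm (ENNReal.ofReal q) (y - x) with ha
  set b := lpNorm (ENNReal.ofReal q) z with hb
  have ha0 : 0 ≤ a := lpNorm_ofReal_nonneg hq0 _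
  have hb0 : 0 ≤ b := lpNorm_ofReal_nonneg hq0 _
  have hall : ∀ s : ℝ, 0 ≤ s → 2 * s * (G ⬝ᵥ z) ≤ (q - 1) * (a ^ 2 + (s * b) ^ 2) := by
    intro s hs
    have := hsum s hs
    nlinarith
  -- The optimal `s` is `a / b`; for `a = 0` or `b = 0` it is a limiting case.
  rcases hb0.eq_or_lt with hbz | hbp
  · rw [← hbz, mul_zero, mul_zero]
    by_contra! hpos
    have := hall (((q - 1) * a ^ 2 + 1) / (G ⬝ᵥ z))
      (div_nonneg (by nlinarith [sq_nonneg a]) hpos.le)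
    rw [← hbz, mul_assoc, div_mul_cancel₀ _ hpos.ne'] at this
    nlinarith [sq_nonneg a]
  · rcases ha0.eq_or_lt with haz | hap
    · rw [← haz, zero_mul, mul_zero]
      by_contra! hpos
      have hc : 0 < (q - 1) * b ^ 2 := mul_pos (by linarith) (by positivity)
      have := hall ((G ⬝ᵥ z) / ((q - 1) * b ^ 2)) (by positivity)
      rw [← haz] at this
      have h3 : (q - 1) * (0 ^ 2 + ((G ⬝ᵥ z) / ((q - 1) * b ^ 2) * b) ^ 2)
          = (G ⬝ᵥ z) ^ 2 / ((q - 1) * b ^ 2) := by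
        have : q - 1 ≠ 0 := by linarith
        field_simp
        ring
      have h4 : 2 * ((G ⬝ᵥ z) / ((q - 1) * b ^ 2)) * (G ⬝ᵥ z)
          = 2 * ((G ⬝ᵥ z) ^ 2 / ((q - 1) * b ^ 2)) := by ring
      have h5 : 0 < (G ⬝ᵥ z) ^ 2 / ((q - 1) * b ^ 2) := by positivity
      rw [h3, h4] at this
      linarith
    · have := hall (a / b) (by positivity)
      rw [div_mul_cancel₀ _ hbp.ne'] at this
      have h2 : 2 * (a / b) * (G ⬝ᵥ z) = 2 * a * ((G ⬝ᵥ z) / b) := by ring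
      rw [h2] at this
      have h3 : (G ⬝ᵥ z) / b ≤ (q - 1) * a := by
        have : a * ((G ⬝ᵥ z) / b) ≤ a * ((q - 1) * a) := by nlinarith
        exact le_of_mul_le_mul_left this hap
      rw [div_le_iff₀ hbp] at h3
      linarith

/-- The growth of the potential when the regret `r` is added, in terms of the gradient at a
prediction `θ` that misses the new point by `e`. -/
theorem posPotential_sub_le_huber {d : ℕ} {q : ℝ} (hq : 2 ≤ q) (θ e r : Fin d → ℝ) :
    posPotential q (θ + e) - posPotential q (θ + e - r) ≤ posGrad q θ ⬝ᵥ r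
      + (q - 1) * huber (lpNorm (ENNReal.ofReal q) e) (lpNorm (ENNReal.ofReal q) r) := by
  have hq0 : 0 < q := by linarith
  obtain ⟨α, h0, h1, hα⟩ := exists_huber_eq (lpNorm_ofReal_nonneg hq0 e)
    (lpNorm_ofReal_nonneg hq0 r)
  -- Both values are compared with the tangent at the intermediate point `θ + (1 - α) e`.
  set y := θ + (1 - α) • e with hy
  have hup := posPotential_smooth hq y (α • e)
  have hlow := posPotential_tangent_le hq y (θ + e - r)
  have hlip := posGrad_sub_dotProduct_le hq θ y r
  rw [show y + α • e = θ + e by rw [hy]; module, lpNorm_ofReal_smul hq0 h0] at hup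
  rw [show θ + e - r - y = α • e - r by rw [hy]; module, dotProduct_sub] at hlow
  rw [show y - θ = (1 - α) • e by rw [hy]; module,
    lpNorm_ofReal_smul hq0 (sub_nonneg.2 h1), sub_dotProduct] at hlip
  rw [← hα]
  linarith

/-- The counterpart of `posPotential_sub_le_huber` for mirror steps: the gain from the movement of
the gradient along `e`, minus the Bregman divergence paid for that movement. -/
theorem posGrad_sub_dotProduct_sub_bregman_le_huber {d : ℕ} {q : ℝ} (hq : 2 ≤ q)
    (θ ρ e : Fin d → ℝ) :
    (posGrad q (θ + ρ) - posGrad q θ) ⬝ᵥ e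
        - (posPotential q θ - posPotential q (θ + ρ) + posGrad q (θ + ρ) ⬝ᵥ ρ) ≤
      (q - 1) * huber (lpNorm (ENNReal.ofReal q) e) (lpNorm (ENNReal.ofReal q) ρ) := by
  have hq0 : 0 < q := by linarith
  obtain ⟨α, h0, h1, hα⟩ := exists_huber_eq (lpNorm_ofReal_nonneg hq0 e)
    (lpNorm_ofReal_nonneg hq0 ρ)
  have hbreg := posGrad_sub_dotProduct_le_bregman hq θ (θ + ρ) (α • e)
  have hlip := posGrad_sub_dotProduct_le hq θ (θ + ρ) ((1 - α) • e)
  rw [lpNorm_ofReal_smul hq0 h0, dotProduct_smul, smul_eq_mul,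
    show θ - (θ + ρ) = -ρ by abel, dotProduct_neg] at hbreg
  rw [lpNorm_ofReal_smul hq0 (sub_nonneg.2 h1), dotProduct_smul, smul_eq_mul,
    add_sub_cancel_left] at hlip
  rw [← hα]
  linarith

/-! ### Potential bounds along the iterates -/

theorem sum_Icc_one_add_sum_Icc {d : ℕ} {r : ℕ → Fin d → ℝ} (hr : r 0 = 0) {m t : ℕ}
    (hmt : m ≤ t + 1) :
    ∑ s ∈ Finset.Icc 1 (m - 1), r s + ∑ s ∈ Finset.Icc m t, r s = ∑ s ∈ Finset.Icc 1 t, r s := by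
  rcases Nat.eq_zero_or_pos m with rfl | hm
  · rw [show Finset.Icc 1 (0 - 1) = ∅ by simp, Finset.sum_empty, zero_add,
      ← Finset.add_sum_Ioc_eq_sum_Icc (Nat.zero_le t), hr, zero_add]
    rfl
  · rw [← Finset.sum_union]
    · congr 1
      ext s
      simp only [Finset.mem_union, Finset.mem_Icc]
      omega
    · rw [Finset.disjoint_left]
      intro s
      simp only [Finset.mem_Icc]
      omega

theorem sum_Icc_one_succ {d : ℕ} (r : ℕ → Fin d → ℝ) (n : ℕ) :
    ∑ s ∈ Finset.Icc 1 (n + 1), r s = ∑ s ∈ Finset.Icc 1 n, r s + r (n + 1) :=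
  Finset.sum_Icc_succ_top (by omega) r

/-- The dual variable of DORM in round `t`: the observed regrets plus the hint. -/
def dormDual {d : ℕ} (D : ℕ) (r h : ℕ → Fin d → ℝ) (t : ℕ) : Fin d → ℝ :=
  ∑ s ∈ Finset.Icc 1 (t - 1 - D), r s + h t

theorem dorm_posPotential_le {d : ℕ} {q : ℝ} (hq : 2 ≤ q) (D : ℕ) {r h : ℕ → Fin d → ℝ}
    (hr : r 0 = 0) {T : ℕ}
    (horth : ∀ t ∈ Finset.Icc 1 T, posGrad q (dormDual D r h t) ⬝ᵥ r t = 0) :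
    posPotential q (∑ s ∈ Finset.Icc 1 T, r s) ≤
      (q - 1) * ∑ t ∈ Finset.Icc 1 T, dormB D r h (ENNReal.ofReal q) t := by
  induction T with
  | zero => simp [posPotential_zero hq]
  | succ n ih =>
    have ih := ih fun t ht => horth t (Finset.Icc_subset_Icc_right (Nat.le_succ n) ht)
    have h0 := horth (n + 1) (by simp)
    set e := ∑ s ∈ Finset.Icc (n + 1 - D) (n + 1), r s - h (n + 1) with he
    have hsum : dormDual D r h (n + 1) + e = ∑ s ∈ Finset.Icc 1 (n + 1), r s := by
      rw [← sum_Icc_one_add_sum_Icc hr (m := n + 1 - D) (by omega), dormDual, he,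
        show n + 1 - 1 - D = n + 1 - D - 1 by omega]
      abel
    have hstep := posPotential_sub_le_huber hq (dormDual D r h (n + 1)) e (r (n + 1))
    rw [h0, zero_add, hsum] at hstep
    have hprev : ∑ s ∈ Finset.Icc 1 (n + 1), r s - r (n + 1) = ∑ s ∈ Finset.Icc 1 n, r s := by
      rw [sum_Icc_one_succ, add_sub_cancel_right]
    rw [hprev, he, lpNorm_ofReal_sub_comm (by linarith)] at hstep
    rw [Finset.sum_Icc_succ_top (by omega : 1 ≤ n + 1) (dormB D r h (ENNReal.ofReal q)), mul_add]
    unfold dormB at ih ⊢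
    linarith

/-- The dual variables `θ_t` of DORM+: each step adds the newly observed regret and the change of
the hint, then takes the positive part. The DORM+ weights are `(θ_t / λ)^(q - 1)`, so `θ_t` does
not depend on `λ`. -/
noncomputable def dormPlusDual {d : ℕ} (D : ℕ) (r h : ℕ → Fin d → ℝ) : ℕ → Fin d → ℝ
  | 0 => 0
  | t + 1 => fun j => max 0 ((dormPlusDual D r h t + (r (t - D) + h (t + 1) - h t)) j)

theorem dormPlusDual_congr {d : ℕ} (D : ℕ) (r : ℕ → Fin d → ℝ) {h h' : ℕ → Fin d → ℝ} {t : ℕ}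
    (hh : ∀ s ≤ t, h s = h' s) : dormPlusDual D r h t = dormPlusDual D r h' t := by
  induction t with
  | zero => rfl
  | succ n ih =>
    simp only [dormPlusDual]
    rw [ih fun s hs => hh s (by omega), hh (n + 1) le_rfl, hh n (by omega)]

theorem le_dormPlusDual {d : ℕ} (D : ℕ) {r h : ℕ → Fin d → ℝ} (hr : r 0 = 0) (hh : h 0 = 0)
    (n : ℕ) (j : Fin d) :
    (∑ s ∈ Finset.Icc 1 (n - D), r s + h (n + 1)) j ≤ dormPlusDual D r h (n + 1) j := by
  induction n with
  | zero => simp [dormPlusDual, hr, hh]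
  | succ n ih =>
    rw [dormPlusDual]
    refine le_trans ?_ (le_max_right _ _)
    have hS : ∑ s ∈ Finset.Icc 1 (n + 1 - D), r s
        = ∑ s ∈ Finset.Icc 1 (n - D), r s + r (n + 1 - D) := by
      rcases Nat.lt_or_ge n D with h1 | h1
      · rw [show n + 1 - D = 0 by omega, show n - D = 0 by omega, hr, add_zero]
      · rw [show n + 1 - D = n - D + 1 by omega, sum_Icc_one_succ]
    rw [hS]
    simp only [Pi.add_apply, Pi.sub_apply] at ih ⊢
    linarith

/-- The potential of the DORM+ dual variable, corrected by the prediction error pending at the end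
of round `n`. The correction makes the telescoping exact. -/
theorem dormPlus_posPotential_add_le {d : ℕ} {q : ℝ} (hq : 2 ≤ q) (D : ℕ) {r h : ℕ → Fin d → ℝ}
    (hr : r 0 = 0) (hh : h 0 = 0) {n : ℕ}
    (horth : ∀ t ∈ Finset.Icc 1 n, posGrad q (dormPlusDual D r h t) ⬝ᵥ r t = 0) :
    posPotential q (dormPlusDual D r h (n + 1)) + posGrad q (dormPlusDual D r h (n + 1)) ⬝ᵥ
        (∑ s ∈ Finset.Icc 1 n, r s - ∑ s ∈ Finset.Icc 1 (n - D), r s - h (n + 1)) ≤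
      (q - 1) * ∑ t ∈ Finset.Icc 1 n,
        huber (lpNorm (ENNReal.ofReal q) (h t - ∑ s ∈ Finset.Icc (t - D) t, r s))
          (lpNorm (ENNReal.ofReal q) (r (t - D) + h (t + 1) - h t)) := by
  have hΦ : ∀ t, posPotential q (dormPlusDual D r h (t + 1)) =
      posPotential q (dormPlusDual D r h t + (r (t - D) + h (t + 1) - h t)) := fun t =>
    posPotential_max q _
  have hG : ∀ t, posGrad q (dormPlusDual D r h (t + 1)) =
      posGrad q (dormPlusDual D r h t + (r (t - D) + h (t + 1) - h t)) := fun t =>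
    posGrad_max q _
  induction n with
  | zero =>
    have h1 := posPotential_tangent_le hq (h 1) 0
    rw [posPotential_zero hq] at h1
    rw [hΦ, hG]
    simpa [dormPlusDual, hr, hh] using h1
  | succ n ih =>
    have ih := ih fun t ht => horth t (Finset.Icc_subset_Icc_right (Nat.le_succ n) ht)
    have h0 := horth (n + 1) (by simp)
    set θ := dormPlusDual D r h (n + 1) with hθ
    set ρ := r (n + 1 - D) + h (n + 1 + 1) - h (n + 1) with hρ
    set e := ∑ s ∈ Finset.Icc (n + 1 - D) (n + 1), r s - h (n + 1) with he
    have hstep := posGrad_sub_dotProduct_sub_bregman_le_huber hq θ ρ e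
    have hsplit := sum_Icc_one_add_sum_Icc hr (m := n + 1 - D) (t := n + 1) (by omega)
    have hlag : ∑ s ∈ Finset.Icc 1 (n + 1 - D), r s
        = ∑ s ∈ Finset.Icc 1 (n + 1 - D - 1), r s + r (n + 1 - D) := by
      rcases Nat.lt_or_ge n D with h1 | h1
      · rw [show n + 1 - D = 0 by omega, hr, add_zero]
      · rw [show n + 1 - D = n - D + 1 by omega, sum_Icc_one_succ, Nat.add_sub_cancel]
    have hk : ∑ s ∈ Finset.Icc 1 (n + 1), r s - ∑ s ∈ Finset.Icc 1 (n + 1 - D), r s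
        - h (n + 1 + 1) = e - ρ := by
      rw [← hsplit, hlag, he, hρ]
      abel
    have hk' : ∑ s ∈ Finset.Icc 1 n, r s - ∑ s ∈ Finset.Icc 1 (n - D), r s - h (n + 1)
        = e - r (n + 1) := by
      rw [he, show n - D = n + 1 - D - 1 by omega, eq_sub_iff_add_eq]
      have h2 := sum_Icc_one_succ r n
      rw [← hsplit] at h2
      rw [sub_add_eq_add_sub, sub_add_eq_add_sub, ← h2]
      abel
    rw [hk', dotProduct_sub, h0, sub_zero] at ih
    rw [hk, hΦ, hG, ← hθ, ← hρ, Finset.sum_Icc_succ_top (by omega : 1 ≤ n + 1), mul_add,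
      dotProduct_sub]
    rw [he, lpNorm_ofReal_sub_comm (by linarith), ← he, sub_dotProduct] at hstep
    linarith

/-- The vector `θ` is the dual variable of round `T + 1` for the hints `endHint D T r h`. These agree
with `h` up to round `T`, so the plays are the same, and they leave no prediction error pending at
the end of round `T`. -/
theorem sum_le_dormPlusDual_and_posPotential_le {d : ℕ} {q : ℝ} (hq : 2 ≤ q) (D T : ℕ)
    {r h : ℕ → Fin d → ℝ} (hr : r 0 = 0) (hh : h 0 = 0)
    (horth : ∀ t ∈ Finset.Icc 1 T, posGrad q (dormPlusDual D r h t) ⬝ᵥ r t = 0) :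
    ∃ θ : Fin d → ℝ, (∀ j, (∑ s ∈ Finset.Icc 1 T, r s) j ≤ θ j) ∧
      posPotential q θ ≤
        (q - 1) * ∑ t ∈ Finset.Icc 1 T, dormPlusB D T r h (ENNReal.ofReal q) t := by
  set h' := endHint D T r h with hh'
  have hagree : ∀ s ≤ T, h s = h' s := fun s hs => by
    rw [hh', endHint, Function.update_of_ne (by omega)]
  have hend : ∑ s ∈ Finset.Icc 1 (T - D), r s + h' (T + 1) = ∑ s ∈ Finset.Icc 1 T, r s := by
    rw [hh', endHint, Function.update_self, show T - D = T + 1 - D - 1 by omega]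
    exact sum_Icc_one_add_sum_Icc hr (by omega)
  have hh0 : h' 0 = 0 := by rw [← hagree 0 (Nat.zero_le T), hh]
  refine ⟨dormPlusDual D r h' (T + 1), fun j => ?_, ?_⟩
  · rw [← hend]
    exact le_dormPlusDual D hr hh0 T j
  · have key := dormPlus_posPotential_add_le hq D hr hh0 (n := T) fun t ht => by
      rw [← dormPlusDual_congr D r fun s hs => hagree s (hs.trans (Finset.mem_Icc.1 ht).2)]
      exact horth t ht
    rw [← hend, add_sub_cancel_left, sub_self, dotProduct_zero, add_zero] at key
    refine key.trans_eq ?_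
    congr 1
    refine Finset.sum_congr rfl fun t ht => ?_
    rw [dormPlusB, hagree t (Finset.mem_Icc.1 ht).2]

/-! ### Orthogonality of plays and regrets -/

theorem instRegret_dotProduct {d : ℕ} (g w : ℕ → Fin d → ℝ) {t : ℕ} (ht : 1 ≤ t)
    (v : Fin d → ℝ) :
    instRegret g w t ⬝ᵥ v = (g t ⬝ᵥ w t) * ∑ j, v j - g t ⬝ᵥ v := by
  obtain ⟨n, rfl⟩ : ∃ n, t = n + 1 := ⟨t - 1, by omega⟩
  simp only [instRegret, dotProduct, sub_mul, Finset.sum_sub_distrib, Finset.mul_sum]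

theorem dotProduct_instRegret_of_isNormalization {d : ℕ} {g w : ℕ → Fin d → ℝ} {t : ℕ}
    (ht : 1 ≤ t) {v : Fin d → ℝ} (hv : ∀ j, 0 ≤ v j) (hn : IsNormalization v (w t)) :
    v ⬝ᵥ instRegret g w t = 0 := by
  rw [dotProduct_comm]
  by_cases h0 : v = 0
  · rw [h0, dotProduct_zero]
  · have hs : ∑ j, v j ≠ 0 := fun hs => h0 <| funext fun j =>
      (Finset.sum_eq_zero_iff_of_nonneg fun j _ => hv j).1 hs j (Finset.mem_univ j)
    have hw : v = (∑ j, v j) • w t := by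
      rw [hn.2 h0, smul_smul, mul_inv_cancel₀ hs, one_smul]
    have h1 : ∑ j, w t j = 1 := hn.1.2
    rw [hw, dotProduct_smul, instRegret_dotProduct g w ht, h1]
    simp

theorem posGrad_dotProduct_instRegret {d : ℕ} {q lam : ℝ} (hlam : 0 < lam)
    {g w : ℕ → Fin d → ℝ} {t : ℕ} (ht : 1 ≤ t) {θ v : Fin d → ℝ}
    (hv : ∀ j, v j = (max 0 (θ j) / lam) ^ (q - 1)) (hn : IsNormalization v (w t)) :
    posGrad q θ ⬝ᵥ instRegret g w t = 0 := by
  have hv0 : ∀ j, 0 ≤ v j := fun j => by rw [hv]; positivity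
  have hG : posGrad q θ =
      ((∑ j, (max 0 (θ j)) ^ q) ^ (2 / q - 1) * lam ^ (q - 1)) • v := by
    funext j
    rw [Pi.smul_apply, smul_eq_mul, hv, posGrad, Real.div_rpow (le_max_left _ _) hlam.le]
    have : lam ^ (q - 1) ≠ 0 := (Real.rpow_pos_of_pos hlam _).ne'
    field_simp
  rw [hG, smul_dotProduct, dotProduct_instRegret_of_isNormalization ht hv0 hn, smul_zero]

theorem max_zero_div {x lam : ℝ} (hlam : 0 < lam) : max 0 (x / lam) = max 0 x / lam := by
  rw [← max_div_div_right hlam.le, zero_div]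

theorem dormWeights_eq {d : ℕ} (D : ℕ) (q : ℝ) {lam : ℝ} (hlam : 0 < lam)
    (r h : ℕ → Fin d → ℝ) {t : ℕ} (ht : 1 ≤ t) (j : Fin d) :
    dormWeights D q lam r h t j = (max 0 (dormDual D r h t j) / lam) ^ (q - 1) := by
  obtain ⟨n, rfl⟩ : ∃ n, t = n + 1 := ⟨t - 1, by omega⟩
  simp only [dormWeights]
  rw [max_zero_div hlam, dormDual, Pi.add_apply, Finset.sum_apply,
    Nat.add_sub_cancel]

theorem dormPlusDual_nonneg {d : ℕ} (D : ℕ) (r h : ℕ → Fin d → ℝ) (t : ℕ) (j : Fin d) :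
    0 ≤ dormPlusDual D r h t j := by
  cases t with
  | zero => exact le_rfl
  | succ n => exact le_max_left _ _

theorem dormPlusWeights_eq {d : ℕ} (D : ℕ) {p q lam : ℝ} (hpq : p.HolderConjugate q)
    (hlam : 0 < lam) (r h : ℕ → Fin d → ℝ) (t : ℕ) (j : Fin d) :
    dormPlusWeights D p q lam r h t j = (max 0 (dormPlusDual D r h t j) / lam) ^ (q - 1) := by
  have hq1 : 0 < q - 1 := sub_pos.2 hpq.symm.lt
  induction t with
  | zero => simp [dormPlusWeights, dormPlusDual, Real.zero_rpow hq1.ne']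
  | succ n ih =>
    have h0 := dormPlusDual_nonneg D r h n j
    have h1 : (q - 1) * (p - 1) = 1 := by
      have := hpq.sub_one_mul_conj
      have := hpq.mul_eq_add
      nlinarith
    simp only [dormPlusWeights]
    rw [ih, max_eq_right h0, ← Real.rpow_mul (by positivity), h1,
      Real.rpow_one, ← add_div, max_zero_div hlam,
      max_eq_right (dormPlusDual_nonneg D r h (n + 1) j), dormPlusDual]
    simp only [Pi.add_apply, Pi.sub_apply, add_sub_assoc]

theorem regret_le_dotProduct {d : ℕ} {loss : ℕ → (Fin d → ℝ) → ℝ} {g w : ℕ → Fin d → ℝ}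
    (hsub : ∀ t, 1 ≤ t → IsSubgradientAt (loss t) (w t) (g t))
    {u : Fin d → ℝ} (hu : u ∈ stdSimplex ℝ (Fin d)) (T : ℕ) :
    regret loss w T u ≤ (∑ s ∈ Finset.Icc 1 T, instRegret g w s) ⬝ᵥ u := by
  rw [regret, sum_dotProduct]
  refine Finset.sum_le_sum fun t ht => ?_
  have ht1 := (Finset.mem_Icc.1 ht).1
  have h := hsub t ht1 u hu
  rw [dotProduct_sub] at h
  rw [instRegret_dotProduct g w ht1, hu.2]
  linarith

/-! ### Norm comparison and optimization over the step size -/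

theorem abs_le_lpNorm_top {d : ℕ} (v : Fin d → ℝ) (i : Fin d) : |v i| ≤ lpNorm ⊤ v :=
  PiLp.norm_apply_le (p := ⊤) (WithLp.toLp ⊤ v) i

theorem lpNorm_top_nonneg {d : ℕ} (v : Fin d → ℝ) : 0 ≤ lpNorm ⊤ v :=
  norm_nonneg (WithLp.toLp ⊤ v : PiLp ⊤ fun _ : Fin d => ℝ)

theorem lpNorm_ofReal_le_lpNorm_top {d : ℕ} {q : ℝ} (hq : 0 < q) (v : Fin d → ℝ) :
    lpNorm (ENNReal.ofReal q) v ≤ (d : ℝ) ^ (1 / q) * lpNorm ⊤ v := by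
  have h0 := lpNorm_top_nonneg v
  have hsum : ∑ i, |v i| ^ q ≤ d * lpNorm ⊤ v ^ q := by
    calc ∑ i, |v i| ^ q ≤ ∑ _i : Fin d, lpNorm ⊤ v ^ q :=
          Finset.sum_le_sum fun i _ =>
            Real.rpow_le_rpow (abs_nonneg _) (abs_le_lpNorm_top v i) hq.le
      _ = _ := by simp
  rw [lpNorm_ofReal hq]
  refine (Real.rpow_le_rpow (by positivity) hsum (by positivity)).trans_eq ?_
  rw [Real.mul_rpow (by positivity) (by positivity), ← Real.rpow_mul h0,
    mul_one_div_cancel hq.ne', Real.rpow_one]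

theorem huber_lpNorm_le {d : ℕ} {q : ℝ} (hq : 0 < q) (v w : Fin d → ℝ) :
    huber (lpNorm (ENNReal.ofReal q) v) (lpNorm (ENNReal.ofReal q) w) ≤
      (d : ℝ) ^ (2 / q) * huber (lpNorm ⊤ v) (lpNorm ⊤ w) := by
  have hd : (0 : ℝ) ≤ d := Nat.cast_nonneg d
  have hsq : (d : ℝ) ^ (2 / q) = ((d : ℝ) ^ (1 / q)) ^ 2 := by
    rw [← Real.rpow_natCast, ← Real.rpow_mul hd]
    push_cast
    ring_nf
  rw [hsq, ← huber_mul_mul (by positivity)]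
  exact huber_le_huber (lpNorm_ofReal_nonneg hq v) (lpNorm_ofReal_nonneg hq w)
    (lpNorm_ofReal_le_lpNorm_top hq v) (lpNorm_ofReal_le_lpNorm_top hq w)

theorem sum_rpow_mem_Ioc_of_mem_stdSimplex {d : ℕ} {p : ℝ} (hp : 1 ≤ p) {u : Fin d → ℝ}
    (hu : u ∈ stdSimplex ℝ (Fin d)) : ∑ i, |u i| ^ p ∈ Set.Ioc (0 : ℝ) 1 := by
  have hle : ∀ i, u i ≤ 1 := fun i => by
    rw [← hu.2]
    exact Finset.single_le_sum (fun j _ => hu.1 j) (Finset.mem_univ i)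
  constructor
  · have hex : ∃ i, u i ≠ 0 := by
      by_contra! h
      have := hu.2
      simp [h] at this
    obtain ⟨i, hi⟩ := hex
    refine Finset.sum_pos' (fun j _ => by positivity) ⟨i, Finset.mem_univ i, ?_⟩
    exact Real.rpow_pos_of_pos (abs_pos.2 hi) _
  · rw [← hu.2]
    refine Finset.sum_le_sum fun i _ => ?_
    rw [abs_of_nonneg (hu.1 i)]
    exact (Real.rpow_le_rpow_of_exponent_ge_of_imp (hu.1 i) (hle i) hp
      (by intro _ h; linarith)).trans_eq (Real.rpow_one _)

/-- The balanced step size `l = √(2 b / a)` gives the infimum; when `b = 0` it is approached as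
`l → 0` but not attained. -/
theorem iInf_half_mul_add_div_eq_sqrt {a b : ℝ} (ha : 0 < a) (hb : 0 ≤ b) :
    ⨅ l : Set.Ioi (0 : ℝ), ((l : ℝ) / 2 * a + b / l) = √(2 * a * b) := by
  have : Nonempty (Set.Ioi (0 : ℝ)) := ⟨⟨1, Set.mem_Ioi.2 one_pos⟩⟩
  set s := √(2 * a * b) with hs
  have hs0 : 0 ≤ s := Real.sqrt_nonneg _
  have hs2 : s ^ 2 = 2 * a * b := Real.sq_sqrt (by positivity)
  have hlow : ∀ l : Set.Ioi (0 : ℝ), s ≤ (l : ℝ) / 2 * a + b / l := by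
    rintro ⟨l, hl⟩
    have hl : 0 < l := hl
    refine Real.sqrt_le_iff.2 ⟨by positivity, ?_⟩
    have hcross : (l / 2 * a) * (b / l) = a * b / 2 := by field_simp
    change _ ≤ (l / 2 * a + b / l) ^ 2
    nlinarith [sq_nonneg (l / 2 * a - b / l)]
  refine le_antisymm (le_of_forall_pos_le_add fun ε hε => ?_) (le_ciInf hlow)
  have hl : 0 < (s + ε) / a := by positivity
  refine (ciInf_le ⟨s, by rintro _ ⟨l, rfl⟩; exact hlow l⟩ ⟨(s + ε) / a, hl⟩).trans ?_
  have h1 : (s + ε) / a / 2 * a = (s + ε) / 2 := by field_simp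
  have h2 : b / ((s + ε) / a) ≤ (s + ε) / 2 := by
    rw [div_le_iff₀ hl]
    have : (s + ε) / 2 * ((s + ε) / a) = (s + ε) ^ 2 / (2 * a) := by field_simp
    rw [this, le_div_iff₀ (by positivity)]
    nlinarith
  change (s + ε) / a / 2 * a + b / ((s + ε) / a) ≤ s + ε
  linarith

/-! ### Regret bounds from a potential bound -/

/-- All the bounds follow from the potential bound by Hölder's inequality and the choice of the
step size. -/
theorem regret_bounds_of_posPotential_le {d T : ℕ} {p q R : ℝ} (hq : 2 ≤ q)
    (hpq : p.HolderConjugate q) {u S θ : Fin d → ℝ} (hu : u ∈ stdSimplex ℝ (Fin d))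
    {B B' : ℕ → ℝ} (hB : ∀ t, 0 ≤ B t) (hBB : ∀ t, B t ≤ (d : ℝ) ^ (2 / q) * B' t)
    (hR : R ≤ S ⬝ᵥ u) (hS : ∀ j, S j ≤ θ j)
    (hθ : posPotential q θ ≤ (q - 1) * ∑ t ∈ Finset.Icc 1 T, B t) :
    R ≤ ⨅ l : Set.Ioi (0 : ℝ), ((l : ℝ) / 2 * lpNorm (ENNReal.ofReal p) u ^ 2
            + 1 / ((l : ℝ) * (p - 1)) * ∑ t ∈ Finset.Icc 1 T, B t)
      ∧ (⨅ l : Set.Ioi (0 : ℝ), ((l : ℝ) / 2 * lpNorm (ENNReal.ofReal p) u ^ 2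
            + 1 / ((l : ℝ) * (p - 1)) * ∑ t ∈ Finset.Icc 1 T, B t))
          = √(2 * lpNorm (ENNReal.ofReal p) u ^ 2 / (p - 1) * ∑ t ∈ Finset.Icc 1 T, B t)
      ∧ √(2 * lpNorm (ENNReal.ofReal p) u ^ 2 / (p - 1) * ∑ t ∈ Finset.Icc 1 T, B t)
          ≤ √(2 * (d : ℝ) ^ (2 / q) * (q - 1) * ∑ t ∈ Finset.Icc 1 T, B' t)
      ∧ (2 ≤ d → IsMinOn (fun q' : ℝ => (d : ℝ) ^ (2 / q') * (q' - 1)) (Set.Ici 2) q →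
          R ≤ 2 * √((2 * Real.logb 2 d - 1) * ∑ t ∈ Finset.Icc 1 T, B' t)) := by
  have hp1 : 0 < p - 1 := sub_pos.2 hpq.lt
  have hq1 : 0 < q - 1 := by linarith
  have hpq1 : (q - 1) * (p - 1) = 1 := by
    have := hpq.mul_eq_add
    nlinarith
  have hinv : q - 1 = 1 / (p - 1) := by rw [eq_div_iff hp1.ne', hpq1]
  have hN0 := lpNorm_ofReal_nonneg hpq.pos u
  obtain ⟨hu0, hu1⟩ := sum_rpow_mem_Ioc_of_mem_stdSimplex hpq.lt.le hu
  have hNpos : 0 < lpNorm (ENNReal.ofReal p) u := by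
    rw [lpNorm_ofReal hpq.pos]
    exact Real.rpow_pos_of_pos hu0 _
  have hNle : lpNorm (ENNReal.ofReal p) u ≤ 1 := by
    rw [lpNorm_ofReal hpq.pos]
    exact Real.rpow_le_one hu0.le hu1 (by have := hpq.pos; positivity)
  have hsum0 : 0 ≤ ∑ t ∈ Finset.Icc 1 T, B t := Finset.sum_nonneg fun t _ => hB t
  have hsumle : ∑ t ∈ Finset.Icc 1 T, B t ≤ (d : ℝ) ^ (2 / q) * ∑ t ∈ Finset.Icc 1 T, B' t := by
    rw [Finset.mul_sum]
    exact Finset.sum_le_sum fun t _ => hBB t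
  set N := lpNorm (ENNReal.ofReal p) u with hN
  set sB := ∑ t ∈ Finset.Icc 1 T, B t with hsB
  set sB' := ∑ t ∈ Finset.Icc 1 T, B' t with hsB'
  have hinf : (⨅ l : Set.Ioi (0 : ℝ), ((l : ℝ) / 2 * N ^ 2 + 1 / ((l : ℝ) * (p - 1)) * sB))
      = √(2 * N ^ 2 / (p - 1) * sB) := by
    have h := iInf_half_mul_add_div_eq_sqrt (a := N ^ 2) (b := sB / (p - 1)) (by positivity)
      (by positivity)
    rw [show 2 * N ^ 2 / (p - 1) * sB = 2 * N ^ 2 * (sB / (p - 1)) by ring, ← h]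
    refine iInf_congr fun l => ?_
    congr 1
    rw [one_div_mul_eq_div, div_div, mul_comm (p - 1)]
  have hreg : R ≤ √(2 * N ^ 2 / (p - 1) * sB) := by
    calc R ≤ S ⬝ᵥ u := hR
      _ ≤ θ ⬝ᵥ u := Finset.sum_le_sum fun j _ => mul_le_mul_of_nonneg_right (hS j) (hu.1 j)
      _ ≤ N * √(2 * posPotential q θ) := dotProduct_le_lpNorm_mul_sqrt hq hpq θ u hu.1
      _ ≤ N * √(2 * ((q - 1) * sB)) := by gcongr
      _ = √(2 * N ^ 2 / (p - 1) * sB) := by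
        rw [show 2 * N ^ 2 / (p - 1) * sB = N ^ 2 * (2 * ((q - 1) * sB)) by rw [hinv]; ring,
          Real.sqrt_mul (sq_nonneg N) (2 * ((q - 1) * sB)), Real.sqrt_sq hN0]
  have hsqrt : √(2 * N ^ 2 / (p - 1) * sB) ≤ √(2 * (d : ℝ) ^ (2 / q) * (q - 1) * sB') := by
    refine Real.sqrt_le_sqrt ?_
    have hN2 : N ^ 2 ≤ 1 := pow_le_one₀ hN0 hNle
    calc 2 * N ^ 2 / (p - 1) * sB = (2 * (q - 1) * sB) * N ^ 2 := by rw [hinv]; ring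
      _ ≤ (2 * (q - 1) * sB) * 1 := by gcongr
      _ ≤ 2 * (q - 1) * ((d : ℝ) ^ (2 / q) * sB') := by rw [mul_one]; gcongr
      _ = _ := by ring
  refine ⟨hinf ▸ hreg, hinf, hsqrt, fun hd hmin => hreg.trans (hsqrt.trans ?_)⟩
  have hd2 : (2 : ℝ) ≤ d := by exact_mod_cast hd
  have hs0 : 0 ≤ sB' := by
    have hpos : 0 < (d : ℝ) ^ (2 / q) := Real.rpow_pos_of_pos (by linarith) _
    exact nonneg_of_mul_nonneg_right (hsum0.trans hsumle) hpos
  -- The minimizer `q` is compared with `2 log₂ d`, for which `d ^ (2 / (2 log₂ d)) = 2`.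
  have hlog : 1 ≤ Real.logb 2 d := by
    rw [Real.le_logb_iff_rpow_le one_lt_two (by linarith), Real.rpow_one]
    exact hd2
  have hcomp : (d : ℝ) ^ (2 / q) * (q - 1) ≤ 2 * (2 * Real.logb 2 d - 1) := by
    have h1 := isMinOn_iff.1 hmin (2 * Real.logb 2 d) (Set.mem_Ici.2 (by linarith))
    have h2 : (d : ℝ) ^ (2 / (2 * Real.logb 2 d)) = 2 := by
      conv_lhs => rw [← Real.rpow_logb zero_lt_two (by norm_num) (by linarith : (0 : ℝ) < d)]
      rw [Real.logb_rpow zero_lt_two (by norm_num), ← Real.rpow_mul zero_le_two,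
        show Real.logb 2 d * (2 / (2 * Real.logb 2 d)) = 1 by field_simp, Real.rpow_one]
    simpa only [h2] using h1
  rw [show (2 : ℝ) * √((2 * Real.logb 2 d - 1) * sB')
      = √(2 ^ 2 * ((2 * Real.logb 2 d - 1) * sB')) by
    rw [Real.sqrt_mul (sq_nonneg 2) ((2 * Real.logb 2 d - 1) * sB'), Real.sqrt_sq zero_le_two]]
  refine Real.sqrt_le_sqrt ?_
  nlinarith

end DelayedRegretMatching

open DelayedRegretMatching in
theorem mainTheorem8 (d D T : ℕ) (p q lam : ℝ) (hq : 2 ≤ q) (hp : p = q / (q - 1))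
    (hlam : 0 < lam)
    (loss : ℕ → (Fin d → ℝ) → ℝ) (g h w : ℕ → Fin d → ℝ)
    (hconv : ∀ t, 1 ≤ t → ConvexOn ℝ (stdSimplex ℝ (Fin d)) (loss t))
    (hsub : ∀ t, 1 ≤ t → IsSubgradientAt (loss t) (w t) (g t))
    (u : Fin d → ℝ) (hu : u ∈ stdSimplex ℝ (Fin d)) :
    (IsDORM D q lam g h w →
      regret loss w T u ≤
          ⨅ l : Set.Ioi (0 : ℝ), ((l : ℝ) / 2 * lpNorm (ENNReal.ofReal p) u ^ 2
            + 1 / ((l : ℝ) * (p - 1)) *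
              ∑ t ∈ Finset.Icc 1 T, dormB D (instRegret g w) h (ENNReal.ofReal q) t)
      ∧ (⨅ l : Set.Ioi (0 : ℝ), ((l : ℝ) / 2 * lpNorm (ENNReal.ofReal p) u ^ 2
            + 1 / ((l : ℝ) * (p - 1)) *
              ∑ t ∈ Finset.Icc 1 T, dormB D (instRegret g w) h (ENNReal.ofReal q) t))
          = √(2 * lpNorm (ENNReal.ofReal p) u ^ 2 / (p - 1) *
              ∑ t ∈ Finset.Icc 1 T, dormB D (instRegret g w) h (ENNReal.ofReal q) t)
      ∧ √(2 * lpNorm (ENNReal.ofReal p) u ^ 2 / (p - 1) *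
              ∑ t ∈ Finset.Icc 1 T, dormB D (instRegret g w) h (ENNReal.ofReal q) t)
          ≤ √(2 * (d : ℝ) ^ (2 / q) * (q - 1) *
              ∑ t ∈ Finset.Icc 1 T, dormB D (instRegret g w) h ⊤ t)
      ∧ (2 ≤ d → IsMinOn (fun q' : ℝ => (d : ℝ) ^ (2 / q') * (q' - 1)) (Set.Ici 2) q →
          regret loss w T u ≤ 2 * √((2 * Real.logb 2 d - 1) *
              ∑ t ∈ Finset.Icc 1 T, dormB D (instRegret g w) h ⊤ t)))
    ∧
    (IsDORMPlus D p q lam g h w →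
      regret loss w T u ≤
          ⨅ l : Set.Ioi (0 : ℝ), ((l : ℝ) / 2 * lpNorm (ENNReal.ofReal p) u ^ 2
            + 1 / ((l : ℝ) * (p - 1)) *
              ∑ t ∈ Finset.Icc 1 T, dormPlusB D T (instRegret g w) h (ENNReal.ofReal q) t)
      ∧ (⨅ l : Set.Ioi (0 : ℝ), ((l : ℝ) / 2 * lpNorm (ENNReal.ofReal p) u ^ 2
            + 1 / ((l : ℝ) * (p - 1)) *
              ∑ t ∈ Finset.Icc 1 T, dormPlusB D T (instRegret g w) h (ENNReal.ofReal q) t))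
          = √(2 * lpNorm (ENNReal.ofReal p) u ^ 2 / (p - 1) *
              ∑ t ∈ Finset.Icc 1 T, dormPlusB D T (instRegret g w) h (ENNReal.ofReal q) t)
      ∧ √(2 * lpNorm (ENNReal.ofReal p) u ^ 2 / (p - 1) *
              ∑ t ∈ Finset.Icc 1 T, dormPlusB D T (instRegret g w) h (ENNReal.ofReal q) t)
          ≤ √(2 * (d : ℝ) ^ (2 / q) * (q - 1) *
              ∑ t ∈ Finset.Icc 1 T, dormPlusB D T (instRegret g w) h ⊤ t)
      ∧ (2 ≤ d → IsMinOn (fun q' : ℝ => (d : ℝ) ^ (2 / q') * (q' - 1)) (Set.Ici 2) q →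
          regret loss w T u ≤ 2 * √((2 * Real.logb 2 d - 1) *
              ∑ t ∈ Finset.Icc 1 T, dormPlusB D T (instRegret g w) h ⊤ t))) := by
  have hpq : p.HolderConjugate q := by
    rw [hp]
    exact (Real.HolderConjugate.conjExponent (by linarith)).symm
  have hr : instRegret g w 0 = 0 := rfl
  have hreg := regret_le_dotProduct hsub hu T
  refine ⟨fun hrun => ?_, fun hrun => ?_⟩
  · have hpot := dorm_posPotential_le hq D hr (h := h) (T := T) fun t ht => by
      have ht1 := (Finset.mem_Icc.1 ht).1
      exact posGrad_dotProduct_instRegret hlam ht1 (dormWeights_eq D q hlam _ h ht1)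
        (hrun t ht1)
    exact regret_bounds_of_posPotential_le hq hpq hu (fun t => huber_nonneg _ _)
      (fun t => huber_lpNorm_le (by linarith) _ _) hreg (fun j => le_rfl) hpot
  · obtain ⟨hh, hrun⟩ := hrun
    obtain ⟨θ, hle, hpot⟩ := sum_le_dormPlusDual_and_posPotential_le hq D T hr hh
      fun t ht => by
        have ht1 := (Finset.mem_Icc.1 ht).1
        exact posGrad_dotProduct_instRegret hlam ht1 (dormPlusWeights_eq D hpq hlam _ h t)
          (hrun t ht1)
    exact regret_bounds_of_posPotential_le hq hpq hu (fun t => huber_nonneg _ _)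
      (fun t => huber_lpNorm_le (by linarith) _ _) hreg hle hpot
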